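/- Let $m\ge 1$, $d=2^m$, and let $\rho$ be a density matrix on $m$ qubits, i.e. a positive semidefinite $d\times d$ complex matrix with $\operatorname{tr}\rho=1$. Let $X_1,X_2,\dots$ be independent and each uniformly distributed on the $d^2-1$ non-identity $m$-qubit Pauli operators, i.e. the tensor products $\sigma_{s_1}\otimes\cdots\otimes\sigma_{s_m}$ of the matrices $I,\sigma_x,\sigma_y,\sigma_z$ other than $I\otimes\cdots\otimes I$. Let $0<\eta<\tfrac12$. Define the estimates of $\rho$ given by the matrix-exponentiated-gradient rule with noiseless measurements and constant learning rate $\eta$ by $\hat\rho_1=I/d$ and, for $t\ge 1$, $$\hat\rho_{t+1}=\frac{\exp(G_{t+1})}{\operatorname{tr}\exp(G_{t+1})},\qquad G_{t+1}=\log\hat\rho_t-2\eta\bigl(\operatorname{tr}(\hat\rho_tX_t)-\operatorname{tr}(\rho X_t)\bigr)X_t .$$ Let $\alpha\in(0,1)$. Then for every $\delta\in(0,1)$ and every integer $$T>T_0:=\left(\frac{\frac{d^2-1}{\eta d}\log d+2}{\delta}\right)^{\frac{3}{1-\alpha}}$$ one has $$\Pr\left\{\|\hat\rho_t-\rho\|_F^2<\frac1{t^\alpha}\right\}\ge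 1-\delta ,$$ where $\|\cdot\|_F$ is the Frobenius norm and the probability is taken jointly over the measurement choices $X_1,X_2,\dots$ and over $t$ uniform in $\{1,\dots,T\}$ and independent of them. Moreover, $$\lim_{T\to\infty}\Pr\left\{\|\hat\rho_t-\rho\|_F^2<\frac1{t^\alpha}\right\}=1 .$$ -/

import Mathlib

open MeasureTheory ProbabilityTheory Filter Topology
open scoped ComplexOrder

noncomputable section

namespace MEG

/-- A density matrix (quantum state): positive semidefinite (in particular Hermitian), with
trace one. -/
structure IsDensityMatrix {n : Type*} [Fintype n] (ρ : Matrix n n ℂ) : Prop where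
  posSemidef : ρ.PosSemidef
  trace_eq_one : ρ.trace = 1

/-- The Frobenius norm of a complex matrix, that is Mathlib's `‖A‖` for the norm instance
`Matrix.frobeniusNormedAddCommGroup` (which is not a global instance). -/
def frobeniusNorm {n : Type*} [Fintype n] (A : Matrix n n ℂ) : ℝ :=
  (Matrix.frobeniusNormedAddCommGroup : NormedAddCommGroup (Matrix n n ℂ)).norm A

/-- The single-qubit Pauli matrices: `0, 1, 2, 3` stand for `I, σ_x, σ_y, σ_z`. -/
def pauliMatrix : Fin 4 → Matrix (Fin 2) (Fin 2) ℂ :=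
  ![!![1, 0; 0, 1], !![0, 1; 1, 0], !![0, -Complex.I; Complex.I, 0], !![1, 0; 0, -1]]

/-- The computational basis of `m` qubits: bit strings of length `m`. There are `2 ^ m` of them. -/
abbrev QubitBasis (m : ℕ) : Type := Fin m → Fin 2

/-- The `m`-qubit Pauli operator `σ_{s 0} ⊗ ⋯ ⊗ σ_{s (m-1)}`, written entrywise. -/
def pauliOperator {m : ℕ} (s : Fin m → Fin 4) : Matrix (QubitBasis m) (QubitBasis m) ℂ :=
  Matrix.of fun i j => ∏ k, pauliMatrix (s k) (i k) (j k)

/-- Labels of the `4 ^ m - 1` non-identity Pauli operators on `m` qubits: the label that is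
constantly `0` is the one of the identity. -/
abbrev NonIdentityPauli (m : ℕ) : Type := {s : Fin m → Fin 4 // s ≠ 0}

variable {n : Type*} [Fintype n] [DecidableEq n]

/-- The matrix-exponentiated-gradient update `Update(σ, X, y, η)`: with
`G = log σ - 2 η (tr(σ X) - y) X`, it returns `exp G / tr (exp G)`. The matrix logarithm is given
by the continuous functional calculus of the Hermitian matrix `σ`. -/
def megUpdate (σ X : Matrix n n ℂ) (y η : ℝ) : Matrix n n ℂ :=
  let G : Matrix n n ℂ := cfc Real.log σ - (2 * η * ((σ * X).trace.re - y)) • X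
  (NormedSpace.exp G).trace⁻¹ • NormedSpace.exp G

/-- The estimates of the noiseless algorithm with true state `ρ`, constant learning rate `η` and
observables `X 1, X 2, …`: the estimate at time `1` is `I / d`, and the one at time `t + 1` is the
update of the one at time `t` with observable `X t` and outcome `tr (ρ (X t))`. Time starts at `1`;
the value at `0` is irrelevant. -/
def megEstimate (ρ : Matrix n n ℂ) (η : ℝ) (X : ℕ → Matrix n n ℂ) : ℕ → Matrix n n ℂ
  | 0 => (Fintype.card n : ℂ)⁻¹ • 1
  | 1 => (Fintype.card n : ℂ)⁻¹ • 1
  | t + 2 =>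
      megUpdate (megEstimate ρ η X (t + 1)) (X (t + 1)) (ρ * X (t + 1)).trace.re η

/-- The probability that `‖ρ̂_t - ρ‖_F ^ 2 < 1 / t ^ α`, taken jointly over the random choice
`S 1, S 2, …` of the Pauli measurements (defined on the probability space `(Ω, P)`) and over an
independent time `t` that is uniform on `{1, …, T}`. -/
def successProb {m : ℕ} {Ω : Type*} [MeasurableSpace Ω] (P : Measure Ω)
    (S : ℕ → Ω → NonIdentityPauli m) (ρ : Matrix (QubitBasis m) (QubitBasis m) ℂ)
    (η α : ℝ) (T : ℕ) : ℝ :=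
  (P.prod (uniformOn (Set.Icc 1 T))).real
    {p : Ω × ℕ |
      frobeniusNorm (megEstimate ρ η (fun t => pauliOperator (S t p.1).1) p.2 - ρ) ^ 2
        < 1 / (p.2 : ℝ) ^ α}

end MEG

end

namespace MEG

open scoped Matrix

/-! The proof runs on the potential `tr (ρ log ρ̂_t)`, which is minus the relative entropy of `ρ` to
`ρ̂_t` up to a constant. It starts at `-log d` and is never positive, because `ρ̂_t` has trace one
(`trace_mul_re_nonpos`). Each update raises it by at least `η (tr ((ρ̂_t - ρ) X_t))²`
(`exists_log_megUpdate_progress`): the relative entropy between consecutive estimates controls the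
change of the prediction by Pinsker's inequality (`norm_trace_sq_le_relEntropy`), and completing the
square leaves this gain when `η < 1/2`. So along every measurement sequence the squared prediction
errors sum to at most `log d / η` (`sum_trace_re_sq_le`).

Since `X_t` is independent of `ρ̂_t`, completeness of the Pauli operators makes the expected squared
error at time `t` equal to `d / (d² - 1)` times the expected `‖ρ̂_t - ρ‖_F²`
(`integral_trace_re_sq`). Hence the expected squared distances have a sum bounded uniformly in `T`,
and Markov's inequality averaged over `t ≤ T` bounds the failure probability by a constant times `T
^ (α - 1)`. -/

lemma rational_le_log {t : ℝ} (ht : 0 < t) :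
    (5 * t ^ 2 - 4 * t - 1) / (2 * t ^ 2 + 4 * t) ≤ Real.log t := by
  set h : ℝ → ℝ := fun x => Real.log x - (5 * x ^ 2 - 4 * x - 1) / (2 * x ^ 2 + 4 * x) with hh
  -- The rational function agrees with `log` to third order at `1`, so the derivative of the
  -- difference is a positive multiple of `(x - 1) ^ 3` and the minimum is at `1`.
  have hd : ∀ x : ℝ, 0 < x → HasDerivAt h ((x - 1) ^ 3 / (x ^ 2 * (x + 2) ^ 2)) x := by
    intro x hx
    have h1 : HasDerivAt (fun x : ℝ => 5 * x ^ 2 - 4 * x - 1) (5 * (2 * x) - 4) x := by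
      simpa using (((hasDerivAt_pow 2 x).const_mul 5).sub
        ((hasDerivAt_id x).const_mul 4)).sub_const 1
    have h2 : HasDerivAt (fun x : ℝ => 2 * x ^ 2 + 4 * x) (2 * (2 * x) + 4) x := by
      simpa using ((hasDerivAt_pow 2 x).const_mul 2).fun_add ((hasDerivAt_id x).const_mul 4)
    have h0 : 2 * x ^ 2 + 4 * x ≠ 0 := by positivity
    have := (Real.hasDerivAt_log hx.ne').sub (h1.div h2 h0)
    refine this.congr_deriv ?_
    have e : 2 * x ^ 2 + 4 * x = 2 * x * (x + 2) := by ring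
    have hx2 : x + 2 ≠ 0 := by positivity
    rw [e]
    field_simp
    ring
  have hone : h 1 = 0 := by norm_num [hh]
  suffices 0 ≤ h t by simpa [hh] using this
  rcases le_total 1 t with h1 | h1
  · have : MonotoneOn h (Set.Ici 1) := by
      refine monotoneOn_of_deriv_nonneg (convex_Ici 1)
        (fun x hx => (hd x (zero_lt_one.trans_le hx)).continuousAt.continuousWithinAt)
        (fun x hx => ?_) (fun x hx => ?_)
      all_goals rw [interior_Ici, Set.mem_Ioi] at hx
      · exact (hd x (by linarith)).differentiableAt.differentiableWithinAt
      · rw [(hd x (by linarith)).deriv]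
        have : 0 ≤ x - 1 := by linarith
        positivity
    exact hone ▸ this (Set.mem_Ici.2 le_rfl) (Set.mem_Ici.2 h1) h1
  · have : AntitoneOn h (Set.Ioc 0 1) := by
      refine antitoneOn_of_deriv_nonpos (convex_Ioc 0 1)
        (fun x hx => (hd x hx.1).continuousAt.continuousWithinAt)
        (fun x hx => ?_) (fun x hx => ?_)
      all_goals rw [interior_Ioc, Set.mem_Ioo] at hx
      · exact (hd x hx.1).differentiableAt.differentiableWithinAt
      · rw [(hd x hx.1).deriv]
        refine div_nonpos_of_nonpos_of_nonneg (Odd.pow_nonpos (by decide) (by linarith))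
          (by positivity)
    exact hone ▸ this ⟨ht, h1⟩ ⟨one_pos, le_rfl⟩ h1

/-- A pointwise form of Pinsker's inequality. -/
lemma sq_sub_le_mul_log {x y : ℝ} (hx : 0 < x) (hy : 0 < y) :
    (x - y) ^ 2 ≤ 2 / 3 * (x + 2 * y) * (x * (Real.log x - Real.log y) - x + y) := by
  -- With `t = x / y`, replacing `log t` by its rational bound turns `t log t - t + 1` into exactly
  -- `3 (t - 1)² / (2 (t + 2))`.
  have h := rational_le_log (div_pos hx hy)
  rw [Real.log_div hx.ne' hy.ne'] at h
  have e : (5 * (x / y) ^ 2 - 4 * (x / y) - 1) / (2 * (x / y) ^ 2 + 4 * (x / y)) =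
      (5 * x ^ 2 - 4 * x * y - y ^ 2) / (2 * x * (x + 2 * y)) := by
    have : x + 2 * y ≠ 0 := by positivity
    have e' : 2 * (x / y) ^ 2 + 4 * (x / y) = 2 * x * (x + 2 * y) / y ^ 2 := by
      field_simp
      ring
    rw [e']
    field_simp
  rw [e, div_le_iff₀ (by positivity)] at h
  nlinarith [h]

/-! ### Quantum Pinsker inequality. -/

section RelativeEntropy

variable {n : Type*} [Fintype n] [DecidableEq n]

lemma exists_unitary_diagonalization {A : Matrix n n ℂ} (hA : A.IsHermitian) :
    ∃ U ∈ Matrix.unitaryGroup n ℂ, ∃ a : n → ℝ,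
      A = U * Matrix.diagonal (fun i => (a i : ℂ)) * Uᴴ ∧
      NormedSpace.exp A = U * Matrix.diagonal (fun i => (Real.exp (a i) : ℂ)) * Uᴴ := by
  have hs : A = (hA.eigenvectorUnitary : Matrix n n ℂ) *
      Matrix.diagonal (fun i => (hA.eigenvalues i : ℂ)) *
        (hA.eigenvectorUnitary : Matrix n n ℂ)ᴴ := hA.spectral_theorem
  refine ⟨_, hA.eigenvectorUnitary.2, hA.eigenvalues, hs, ?_⟩
  have hinv : (hA.eigenvectorUnitary : Matrix n n ℂ)⁻¹ =
      (hA.eigenvectorUnitary : Matrix n n ℂ)ᴴ :=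
    Matrix.inv_eq_left_inv (Matrix.mem_unitaryGroup_iff'.1 hA.eigenvectorUnitary.2)
  conv_lhs => rw [hs, ← hinv]
  rw [Matrix.exp_conj _ _ (Unitary.isUnit_coe), Matrix.exp_diagonal, hinv]
  congr 3
  ext i
  simp [Pi.coe_exp, ← Complex.exp_eq_exp_ℂ]

lemma sum_norm_sq_row {U : Matrix n n ℂ} (hU : U ∈ Matrix.unitaryGroup n ℂ) (i : n) :
    ∑ j, ‖U i j‖ ^ 2 = 1 := by
  have := congrFun (congrFun (Matrix.mem_unitaryGroup_iff.1 hU) i) i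
  simp only [Matrix.mul_apply, Matrix.star_apply, Matrix.one_apply_eq, RCLike.star_def,
    Complex.mul_conj'] at this
  exact_mod_cast this

lemma sum_norm_sq_col {U : Matrix n n ℂ} (hU : U ∈ Matrix.unitaryGroup n ℂ) (j : n) :
    ∑ i, ‖U i j‖ ^ 2 = 1 := by
  simpa using sum_norm_sq_row (Unitary.star_mem hU) j

lemma trace_mul_conj_diagonal (X U : Matrix n n ℂ) (p : n → ℂ) :
    (X * (U * Matrix.diagonal p * Uᴴ)).trace = ∑ i, p i * (Uᴴ * X * U) i i := by
  rw [← mul_assoc, ← mul_assoc, Matrix.trace_mul_comm, ← mul_assoc, ← mul_assoc, Matrix.trace]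
  simp [Matrix.mul_diagonal, mul_comm]

/-- **Pinsker's inequality** for density matrices of the form `exp A`, tested on a unitary. -/
lemma norm_trace_sq_le_relEntropy {A B X : Matrix n n ℂ} (hA : A.IsHermitian) (hB : B.IsHermitian)
    (hX : X ∈ Matrix.unitaryGroup n ℂ) (htA : (NormedSpace.exp A).trace = 1)
    (htB : (NormedSpace.exp B).trace = 1) :
    ‖(X * (NormedSpace.exp A - NormedSpace.exp B)).trace‖ ^ 2 ≤
      2 * (NormedSpace.exp A * (A - B)).trace.re := by
  obtain ⟨U, hU, a, hAa, hAe⟩ := exists_unitary_diagonalization hA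
  obtain ⟨V, hV, b, hBb, hBe⟩ := exists_unitary_diagonalization hB
  have hUU : Uᴴ * U = 1 := Matrix.mem_unitaryGroup_iff'.1 hU
  have hUU' : U * Uᴴ = 1 := Matrix.mem_unitaryGroup_iff.1 hU
  have hVV : Vᴴ * V = 1 := Matrix.mem_unitaryGroup_iff'.1 hV
  have hVV' : V * Vᴴ = 1 := Matrix.mem_unitaryGroup_iff.1 hV
  -- `W` compares the two eigenbases and `Y` carries the test unitary. Both are unitary, so their
  -- squared entries form doubly stochastic arrays.
  set W := Uᴴ * V with hW
  set Y := Vᴴ * X * U with hY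
  have hWu : W ∈ Matrix.unitaryGroup n ℂ := mul_mem (Unitary.star_mem hU) hV
  have hYu : Y ∈ Matrix.unitaryGroup n ℂ := mul_mem (mul_mem (Unitary.star_mem hV) hX) hU
  have hsumA : ∑ i, Real.exp (a i) = 1 := by
    have h := trace_mul_conj_diagonal 1 U (fun i => (Real.exp (a i) : ℂ))
    rw [← hAe, one_mul, htA, mul_one, hUU] at h
    simp only [Matrix.one_apply_eq, mul_one] at h
    exact_mod_cast h.symm
  have hsumB : ∑ i, Real.exp (b i) = 1 := by
    have h := trace_mul_conj_diagonal 1 V (fun i => (Real.exp (b i) : ℂ))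
    rw [← hBe, one_mul, htB, mul_one, hVV] at h
    simp only [Matrix.one_apply_eq, mul_one] at h
    exact_mod_cast h.symm
  have hXA : (X * NormedSpace.exp A).trace = ∑ i, ∑ j, (Real.exp (a i) : ℂ) * (W i j * Y j i) := by
    have e : Uᴴ * X * U = W * Y := by
      simp only [hW, hY, mul_assoc]
      rw [← mul_assoc V, hVV', one_mul]
    rw [hAe, trace_mul_conj_diagonal, e]
    simp [Matrix.mul_apply, Finset.mul_sum]
  have hXB : (X * NormedSpace.exp B).trace = ∑ i, ∑ j, (Real.exp (b j) : ℂ) * (W i j * Y j i) := by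
    have e : Vᴴ * X * V = Y * W := by
      simp only [hW, hY, mul_assoc]
      rw [← mul_assoc U, hUU', one_mul]
    rw [hBe, trace_mul_conj_diagonal, e, Finset.sum_comm]
    simp [Matrix.mul_apply, Finset.mul_sum, mul_comm]
  have hAA : (NormedSpace.exp A * A).trace.re = ∑ i, Real.exp (a i) * a i := by
    have e : Uᴴ * NormedSpace.exp A * U = Matrix.diagonal (fun i => (Real.exp (a i) : ℂ)) := by
      rw [hAe]
      simp only [mul_assoc, hUU, mul_one]
      rw [← mul_assoc, hUU, one_mul]
    conv_lhs => enter [1, 1, 2]; rw [hAa]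
    rw [trace_mul_conj_diagonal, e]
    simp only [Matrix.diagonal_apply_eq, Complex.re_sum]
    refine Finset.sum_congr rfl fun i _ => ?_
    rw [← Complex.ofReal_mul, Complex.ofReal_re, mul_comm]
  have hAB : (NormedSpace.exp A * B).trace.re =
      ∑ i, ∑ j, Real.exp (a i) * b j * ‖W i j‖ ^ 2 := by
    have e : Vᴴ * NormedSpace.exp A * V =
        Wᴴ * Matrix.diagonal (fun i => (Real.exp (a i) : ℂ)) * W := by
      rw [hAe, hW]
      simp [mul_assoc]
    conv_lhs => enter [1, 1, 2]; rw [hBb]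
    rw [trace_mul_conj_diagonal, e, Finset.sum_comm]
    simp only [Complex.re_sum]
    refine Finset.sum_congr rfl fun j _ => ?_
    have : (Wᴴ * Matrix.diagonal (fun i => (Real.exp (a i) : ℂ)) * W) j j =
        ((∑ i, Real.exp (a i) * ‖W i j‖ ^ 2 : ℝ) : ℂ) := by
      rw [Matrix.mul_apply]
      simp only [Matrix.mul_diagonal, Matrix.conjTranspose_apply]
      push_cast
      refine Finset.sum_congr rfl fun i _ => ?_
      rw [← Complex.conj_mul', RCLike.star_def]
      ring
    rw [this, ← Complex.ofReal_mul, Complex.ofReal_re, Finset.mul_sum]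
    exact Finset.sum_congr rfl fun i _ => by ring
  -- Cauchy–Schwarz splits the trace into `f`, summing to the relative entropy, and `g`, summing to
  -- `2/3 * (1 + 2) = 2`. The extra terms `-exp a + exp b` in `f` cancel in the sum, both
  -- exponentials having trace one, but make each summand nonnegative.
  set f : n × n → ℝ := fun p => ‖W p.1 p.2‖ ^ 2 *
    (Real.exp (a p.1) * (a p.1 - b p.2) - Real.exp (a p.1) + Real.exp (b p.2)) with hf
  set g : n × n → ℝ := fun p => ‖Y p.2 p.1‖ ^ 2 *
    (2 / 3 * (Real.exp (a p.1) + 2 * Real.exp (b p.2))) with hg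
  have hpt : ∀ i j, (Real.exp (a i) - Real.exp (b j)) ^ 2 ≤
      2 / 3 * (Real.exp (a i) + 2 * Real.exp (b j)) *
        (Real.exp (a i) * (a i - b j) - Real.exp (a i) + Real.exp (b j)) := fun i j => by
    simpa using sq_sub_le_mul_log (Real.exp_pos (a i)) (Real.exp_pos (b j))
  have hk : ∀ i j, 0 ≤ Real.exp (a i) * (a i - b j) - Real.exp (a i) + Real.exp (b j) :=
    fun i j => nonneg_of_mul_nonneg_right ((sq_nonneg _).trans (hpt i j)) (by positivity)
  have hcs := Finset.sum_sq_le_sum_mul_sum_of_sq_le_mul Finset.univ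
    (r := fun p : n × n => |Real.exp (a p.1) - Real.exp (b p.2)| * (‖W p.1 p.2‖ * ‖Y p.2 p.1‖))
    (f := f) (g := g) (fun p _ => mul_nonneg (sq_nonneg _) (hk _ _))
    (fun p _ => by positivity) (fun p _ => by
      rw [mul_pow, sq_abs]
      calc _ ≤ _ := mul_le_mul_of_nonneg_right (hpt p.1 p.2) (sq_nonneg _)
        _ = _ := by simp only [hf, hg]; ring)
  have hsumf : ∑ p, f p = (NormedSpace.exp A * (A - B)).trace.re := by
    rw [mul_sub, Matrix.trace_sub, Complex.sub_re, hAA, hAB, Fintype.sum_prod_type]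
    have h1 : ∑ i, Real.exp (a i) * a i = ∑ i, ∑ j, Real.exp (a i) * a i * ‖W i j‖ ^ 2 := by
      simp_rw [← Finset.mul_sum, sum_norm_sq_row hWu, mul_one]
    have h2 : ∑ i, ∑ j, Real.exp (a i) * ‖W i j‖ ^ 2 = 1 := by
      simp_rw [← Finset.mul_sum, sum_norm_sq_row hWu, mul_one, hsumA]
    have h3 : ∑ i, ∑ j, Real.exp (b j) * ‖W i j‖ ^ 2 = 1 := by
      rw [Finset.sum_comm]
      simp_rw [← Finset.mul_sum, sum_norm_sq_col hWu, mul_one, hsumB]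
    calc _ = ∑ i, ∑ j, Real.exp (a i) * a i * ‖W i j‖ ^ 2
          - ∑ i, ∑ j, Real.exp (a i) * b j * ‖W i j‖ ^ 2
          - ∑ i, ∑ j, Real.exp (a i) * ‖W i j‖ ^ 2
          + ∑ i, ∑ j, Real.exp (b j) * ‖W i j‖ ^ 2 := by
          simp only [← Finset.sum_sub_distrib, ← Finset.sum_add_distrib, hf]
          exact Finset.sum_congr rfl fun i _ => Finset.sum_congr rfl fun j _ => by ring
      _ = _ := by rw [h2, h3, h1]; ring
  have hsumg : ∑ p, g p = 2 := by
    rw [Fintype.sum_prod_type]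
    have h2 : ∑ i, ∑ j, Real.exp (a i) * ‖Y j i‖ ^ 2 = 1 := by
      simp_rw [← Finset.mul_sum, sum_norm_sq_col hYu, mul_one, hsumA]
    have h3 : ∑ i, ∑ j, Real.exp (b j) * ‖Y j i‖ ^ 2 = 1 := by
      rw [Finset.sum_comm]
      simp_rw [← Finset.mul_sum, sum_norm_sq_row hYu, mul_one, hsumB]
    calc _ = 2 / 3 * (∑ i, ∑ j, Real.exp (a i) * ‖Y j i‖ ^ 2
          + 2 * ∑ i, ∑ j, Real.exp (b j) * ‖Y j i‖ ^ 2) := by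
          simp only [Finset.mul_sum, ← Finset.sum_add_distrib, hg]
          exact Finset.sum_congr rfl fun i _ => Finset.sum_congr rfl fun j _ => by ring
      _ = _ := by rw [h2, h3]; norm_num
  rw [hsumf, hsumg, mul_comm] at hcs
  refine le_trans (pow_le_pow_left₀ (norm_nonneg _) ?_ 2) hcs
  rw [mul_sub, Matrix.trace_sub, hXA, hXB, ← Finset.sum_sub_distrib]
  simp only [← Finset.sum_sub_distrib, ← sub_mul]
  rw [← Fintype.sum_prod_type'
    (f := fun i j => ((Real.exp (a i) : ℂ) - (Real.exp (b j) : ℂ)) * (W i j * Y j i))]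
  refine (norm_sum_le _ _).trans_eq (Finset.sum_congr rfl fun p _ => ?_)
  rw [norm_mul, norm_mul, ← Complex.ofReal_sub, Complex.norm_real, Real.norm_eq_abs]

end RelativeEntropy

/-! ### Pauli operators as a complete orthogonal family. -/

section Pauli

lemma pauliMatrix_isHermitian (s : Fin 4) : (pauliMatrix s).IsHermitian := by
  ext i j
  fin_cases s <;> fin_cases i <;> fin_cases j <;> simp [pauliMatrix]

lemma pauliMatrix_mul_self (s : Fin 4) : pauliMatrix s * pauliMatrix s = 1 := by
  ext i j
  fin_cases s <;> fin_cases i <;> fin_cases j <;> simp [pauliMatrix, Matrix.mul_apply]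

lemma sum_pauliMatrix_mul_star (i j k l : Fin 2) :
    ∑ s, pauliMatrix s i j * star (pauliMatrix s k l) = if i = k ∧ j = l then 2 else 0 := by
  fin_cases i <;> fin_cases j <;> fin_cases k <;> fin_cases l <;>
    simp [pauliMatrix, Fin.sum_univ_four] <;> norm_num

variable {m : ℕ}

lemma pauliOperator_isHermitian (s : Fin m → Fin 4) : (pauliOperator s).IsHermitian := by
  ext i j
  simp only [pauliOperator, Matrix.conjTranspose_apply, Matrix.of_apply, star_prod]
  exact Finset.prod_congr rfl fun k _ => (pauliMatrix_isHermitian (s k)).apply _ _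

lemma pauliOperator_mul_self (s : Fin m → Fin 4) : pauliOperator s * pauliOperator s = 1 := by
  ext i j
  have h : ∀ k, ∑ l, pauliMatrix (s k) (i k) l * pauliMatrix (s k) l (j k) =
      if i k = j k then 1 else 0 := fun k => by
    rw [← Matrix.mul_apply, pauliMatrix_mul_self, Matrix.one_apply]
  simp only [pauliOperator, Matrix.mul_apply, Matrix.of_apply, ← Finset.prod_mul_distrib]
  rw [← Fintype.prod_sum (fun k l => pauliMatrix (s k) (i k) l * pauliMatrix (s k) l (j k))]
  simp_rw [h, Matrix.one_apply, Finset.prod_ite_zero, funext_iff]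
  simp

lemma pauliOperator_mem_unitaryGroup (s : Fin m → Fin 4) :
    pauliOperator s ∈ Matrix.unitaryGroup (QubitBasis m) ℂ := by
  rw [Matrix.mem_unitaryGroup_iff, Matrix.star_eq_conjTranspose, (pauliOperator_isHermitian s).eq,
    pauliOperator_mul_self]

lemma pauliOperator_zero : pauliOperator (0 : Fin m → Fin 4) = 1 := by
  ext i j
  have h : pauliMatrix 0 = 1 := by
    ext i j
    fin_cases i <;> fin_cases j <;> simp [pauliMatrix]
  simp only [pauliOperator, Matrix.of_apply, Pi.zero_apply, h, Matrix.one_apply,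
    Finset.prod_ite_zero, funext_iff]
  simp

/-- The sum over labels of a product over qubits is the product of the single-qubit sums, each
giving a factor `2` or `0`. -/
lemma sum_pauliOperator_mul_star (i j k l : QubitBasis m) :
    ∑ s, pauliOperator s i j * star (pauliOperator s k l) =
      if i = k ∧ j = l then (2 : ℂ) ^ m else 0 := by
  simp only [pauliOperator, Matrix.of_apply, star_prod, ← Finset.prod_mul_distrib]
  rw [← Fintype.prod_sum
    (fun r s => pauliMatrix s (i r) (j r) * star (pauliMatrix s (k r) (l r)))]
  simp_rw [sum_pauliMatrix_mul_star, Finset.prod_ite_zero, funext_iff, ← forall_and]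
  simp

lemma frobeniusNorm_sq {n : Type*} [Fintype n] (A : Matrix n n ℂ) :
    frobeniusNorm A ^ 2 = ∑ i, ∑ j, ‖A i j‖ ^ 2 := by
  have h : frobeniusNorm A = (∑ i, ∑ j, ‖A i j‖ ^ (2 : ℝ)) ^ (1 / 2 : ℝ) :=
    Matrix.frobenius_norm_def A
  rw [h, ← Real.sqrt_eq_rpow, Real.sq_sqrt (by positivity)]
  simp

/-- Completeness of the Pauli operators. -/
lemma sum_norm_trace_mul_pauliOperator_sq (A : Matrix (QubitBasis m) (QubitBasis m) ℂ) :
    ∑ s, ‖(A * pauliOperator s).trace‖ ^ 2 = 2 ^ m * frobeniusNorm A ^ 2 := by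
  have h : ∀ s : Fin m → Fin 4, ((‖(A * pauliOperator s).trace‖ ^ 2 : ℝ) : ℂ) =
      ∑ p : QubitBasis m × QubitBasis m, ∑ q : QubitBasis m × QubitBasis m,
        A p.1 p.2 * star (A q.1 q.2) *
          (pauliOperator s p.2 p.1 * star (pauliOperator s q.2 q.1)) := fun s => by
    have e : (A * pauliOperator s).trace =
        ∑ p : QubitBasis m × QubitBasis m, A p.1 p.2 * pauliOperator s p.2 p.1 := by
      rw [Fintype.sum_prod_type]
      simp [Matrix.trace, Matrix.mul_apply]
    push_cast
    rw [← Complex.mul_conj', e, map_sum, Finset.sum_mul_sum]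
    refine Finset.sum_congr rfl fun p _ => Finset.sum_congr rfl fun q _ => ?_
    simp only [map_mul, RCLike.star_def]
    ring
  apply Complex.ofReal_injective
  rw [frobeniusNorm_sq, ← Fintype.sum_prod_type' (f := fun i j => ‖A i j‖ ^ 2)]
  rw [Complex.ofReal_sum]
  simp_rw [h]
  rw [Finset.sum_comm]
  push_cast
  rw [Finset.mul_sum]
  refine Finset.sum_congr rfl fun p _ => ?_
  rw [Finset.sum_comm]
  simp_rw [← Finset.mul_sum, sum_pauliOperator_mul_star]
  rw [Finset.sum_eq_single p]
  · rw [if_pos ⟨rfl, rfl⟩, ← Complex.mul_conj', RCLike.star_def]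
    ring
  · intro q _ hq
    rw [if_neg fun h => hq (Prod.ext h.2.symm h.1.symm), mul_zero]
  · simp

lemma trace_mul_re_sq {n : Type*} [Fintype n] {A X : Matrix n n ℂ} (hA : A.IsHermitian)
    (hX : X.IsHermitian) : (A * X).trace.re ^ 2 = ‖(A * X).trace‖ ^ 2 := by
  have h : star (A * X).trace = (A * X).trace := by
    rw [← Matrix.trace_conjTranspose, Matrix.conjTranspose_mul, hA.eq, hX.eq, Matrix.trace_mul_comm]
  rw [← Complex.conj_eq_iff_re.1 h]
  simp

/-- The identity label contributes `tr A = 0`, so omitting it does not affect completeness. -/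
lemma sum_nonIdentityPauli_trace_re_sq {A : Matrix (QubitBasis m) (QubitBasis m) ℂ}
    (hA : A.IsHermitian) (htr : A.trace = 0) :
    ∑ s : NonIdentityPauli m, (A * pauliOperator s.1).trace.re ^ 2 =
      2 ^ m * frobeniusNorm A ^ 2 := by
  rw [← sum_norm_trace_mul_pauliOperator_sq]
  simp_rw [trace_mul_re_sq hA (pauliOperator_isHermitian _)]
  rw [← Finset.sum_subtype (Finset.univ.erase (0 : Fin m → Fin 4)) (by simp)
    (fun s => ‖(A * pauliOperator s).trace‖ ^ 2), Finset.sum_erase]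
  simp [pauliOperator_zero, htr]

lemma card_nonIdentityPauli : Fintype.card (NonIdentityPauli m) = 4 ^ m - 1 := by
  rw [Fintype.card_subtype_compl, Fintype.card_subtype_eq]
  simp

end Pauli

/-! ### One update, and the pathwise error bound. -/

section Update

variable {n : Type*} [Fintype n] [DecidableEq n]

-- The logarithm in the update undoes the previous exponential, so the recursion is additive in the
-- exponents.
open scoped Matrix.Norms.L2Operator in
lemma cfc_log_exp {H : Matrix n n ℂ} (hH : H.IsHermitian) :
    cfc Real.log (NormedSpace.exp H) = H :=
  CFC.log_exp H hH

lemma exists_trace_exp_eq_sum_exp {H : Matrix n n ℂ} (hH : H.IsHermitian) :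
    ∃ U ∈ Matrix.unitaryGroup n ℂ, ∃ a : n → ℝ,
      H = U * Matrix.diagonal (fun i => (a i : ℂ)) * Uᴴ ∧
      (NormedSpace.exp H).trace = ((∑ i, Real.exp (a i) : ℝ) : ℂ) := by
  obtain ⟨U, hU, a, hHa, hHe⟩ := exists_unitary_diagonalization hH
  refine ⟨U, hU, a, hHa, ?_⟩
  have h := trace_mul_conj_diagonal 1 U (fun i => (Real.exp (a i) : ℂ))
  have hUU : Uᴴ * U = 1 := Matrix.mem_unitaryGroup_iff'.1 hU
  rw [← hHe, one_mul, mul_one, hUU] at h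
  simpa using h

lemma exp_sub_smul_one (G : Matrix n n ℂ) (r : ℝ) :
    NormedSpace.exp (G - r • 1) = (Real.exp (-r) : ℂ) • NormedSpace.exp G := by
  have h : (-(r • 1) : Matrix n n ℂ) = Matrix.diagonal fun _ => ((-r : ℝ) : ℂ) := by
    rw [← Matrix.diagonal_one, ← Matrix.diagonal_smul, Matrix.diagonal_neg]
    congr 1
    ext i
    simp
  have hc : Commute G (-(r • 1)) := ((Commute.one_right G).smul_right r).neg_right
  rw [sub_eq_add_neg, Matrix.exp_add_of_commute _ _ hc, h, Matrix.exp_diagonal]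
  have e : NormedSpace.exp (fun _ : n => ((-r : ℝ) : ℂ)) = fun _ => (Real.exp (-r) : ℂ) := by
    ext i
    simp [Pi.coe_exp, ← Complex.exp_eq_exp_ℂ]
  rw [e, ← Matrix.smul_one_eq_diagonal, mul_smul_comm, mul_one]

lemma exists_log_smul_one [Nonempty n] :
    ∃ H : Matrix n n ℂ, H.IsHermitian ∧ (NormedSpace.exp H).trace = 1 ∧
      NormedSpace.exp H = (Fintype.card n : ℂ)⁻¹ • 1 ∧
      H = -(Real.log (Fintype.card n) • 1) := by
  have hcard : (0 : ℝ) < Fintype.card n := by exact_mod_cast Fintype.card_pos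
  have h : NormedSpace.exp (-(Real.log (Fintype.card n) • 1) : Matrix n n ℂ) =
      (Fintype.card n : ℂ)⁻¹ • 1 := by
    have := exp_sub_smul_one (0 : Matrix n n ℂ) (Real.log (Fintype.card n))
    rwa [zero_sub, NormedSpace.exp_zero, Real.exp_neg, Real.exp_log hcard, Complex.ofReal_inv,
      Complex.ofReal_natCast] at this
  refine ⟨_, ?_, ?_, h, rfl⟩
  · exact ((Matrix.isHermitian_one).smul (IsSelfAdjoint.all _)).neg
  · rw [h]
    simp

/-- The scalar `r` is the log of the normalizing trace. As a multiple of the identity it contributes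
equally against every trace-one matrix, and so cancels later. -/
lemma exists_log_megUpdate [Nonempty n] {H X : Matrix n n ℂ} (hH : H.IsHermitian)
    (hX : X.IsHermitian) (y η : ℝ) :
    ∃ (H' : Matrix n n ℂ) (r : ℝ), H'.IsHermitian ∧ (NormedSpace.exp H').trace = 1 ∧
      NormedSpace.exp H' = megUpdate (NormedSpace.exp H) X y η ∧
      H' - H = -((2 * η * ((NormedSpace.exp H * X).trace.re - y)) • X) - r • 1 := by
  set c : ℝ := 2 * η * ((NormedSpace.exp H * X).trace.re - y) with hc
  have hG : (H - c • X).IsHermitian := hH.sub (hX.smul (IsSelfAdjoint.all _))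
  obtain ⟨U, hU, a, -, htr⟩ := exists_trace_exp_eq_sum_exp hG
  set Z : ℝ := ∑ i, Real.exp (a i) with hZ
  have hZ0 : 0 < Z := Finset.sum_pos (fun i _ => Real.exp_pos _) Finset.univ_nonempty
  have he := exp_sub_smul_one (H - c • X) (Real.log Z)
  rw [Real.exp_neg, Real.exp_log hZ0, Complex.ofReal_inv] at he
  refine ⟨H - c • X - Real.log Z • 1, Real.log Z, ?_, ?_, ?_, ?_⟩
  · exact hG.sub (Matrix.isHermitian_one.smul (IsSelfAdjoint.all _))
  · rw [he, Matrix.trace_smul, htr, smul_eq_mul, inv_mul_cancel₀]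
    exact_mod_cast hZ0.ne'
  · rw [he, megUpdate, cfc_log_exp hH, ← hc, ← htr]
  · abel

/-- The eigenvalues of `exp H` are positive and sum to one, so those of `H` are nonpositive. -/
lemma trace_mul_re_nonpos {ρ H : Matrix n n ℂ} (hρ : ρ.PosSemidef) (hH : H.IsHermitian)
    (htr : (NormedSpace.exp H).trace = 1) : (ρ * H).trace.re ≤ 0 := by
  obtain ⟨U, hU, a, hHa, hsum⟩ := exists_trace_exp_eq_sum_exp hH
  rw [htr] at hsum
  have hsum' : ∑ i, Real.exp (a i) = 1 := by exact_mod_cast hsum.symm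
  have ha : ∀ i, a i ≤ 0 := fun i => by
    rw [← Real.exp_le_one_iff, ← hsum']
    exact Finset.single_le_sum (f := fun i => Real.exp (a i)) (fun _ _ => (Real.exp_pos _).le)
      (Finset.mem_univ i)
  rw [hHa, trace_mul_conj_diagonal, Complex.re_sum]
  refine Finset.sum_nonpos fun i _ => ?_
  rw [Complex.re_ofReal_mul]
  refine mul_nonpos_of_nonpos_of_nonneg (ha i) ?_
  exact (Complex.le_def.1 ((hρ.conjTranspose_mul_mul_same U).diag_nonneg (i := i))).1

/-- One update decreases the relative entropy to the true state by at least `η` times the squared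
prediction error. -/
lemma exists_log_megUpdate_progress [Nonempty n] {H X ρ : Matrix n n ℂ} (hH : H.IsHermitian)
    (htr : (NormedSpace.exp H).trace = 1) (hX : X.IsHermitian)
    (hXu : X ∈ Matrix.unitaryGroup n ℂ) (hρ : ρ.trace = 1) {η : ℝ} (hη₀ : 0 < η)
    (hη₁ : η < 1 / 2) :
    ∃ H' : Matrix n n ℂ, H'.IsHermitian ∧ (NormedSpace.exp H').trace = 1 ∧
      NormedSpace.exp H' = megUpdate (NormedSpace.exp H) X (ρ * X).trace.re η ∧
      (ρ * H).trace.re + η * ((NormedSpace.exp H - ρ) * X).trace.re ^ 2 ≤ (ρ * H').trace.re := by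
  obtain ⟨H', r, hH', htr', hexp, hdiff⟩ := exists_log_megUpdate hH hX (ρ * X).trace.re η
  refine ⟨H', hH', htr', hexp, ?_⟩
  have hP := norm_trace_sq_le_relEntropy hH' hH hXu htr' htr
  have hgen : ∀ A : Matrix n n ℂ, A.trace = 1 → (A * (H' - H)).trace.re =
      -(2 * η * ((NormedSpace.exp H * X).trace.re - (ρ * X).trace.re) * (A * X).trace.re) - r := by
    intro A hA
    rw [hdiff, mul_sub, mul_neg, Matrix.mul_smul, Matrix.mul_smul, mul_one]
    simp [hA]
  have h1 := hgen _ htr'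
  have h2 := hgen _ hρ
  have h3 : ((X * (NormedSpace.exp H' - NormedSpace.exp H)).trace.re) ^ 2 ≤
      ‖(X * (NormedSpace.exp H' - NormedSpace.exp H)).trace‖ ^ 2 :=
    sq_le_sq' (by linarith [neg_abs_le (X * (NormedSpace.exp H' - NormedSpace.exp H)).trace.re,
      Complex.abs_re_le_norm (X * (NormedSpace.exp H' - NormedSpace.exp H)).trace])
      (Complex.re_le_norm _)
  rw [Matrix.trace_mul_comm X, sub_mul, Matrix.trace_sub, Complex.sub_re] at h3
  rw [Matrix.trace_mul_comm X, sub_mul, Matrix.trace_sub] at hP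
  rw [mul_sub, Matrix.trace_sub, Complex.sub_re] at h2
  rw [sub_mul, Matrix.trace_sub, Complex.sub_re]
  set c' := (NormedSpace.exp H' * X).trace.re
  set c := (NormedSpace.exp H * X).trace.re
  set y := (ρ * X).trace.re
  set S := (NormedSpace.exp H' * (H' - H)).trace.re
  -- The gain is `S + 2η(c - y)(c' - y)` with `S ≥ (c' - c)² / 2`, hence at least `(c' - c + 2η(c -
  -- y))² / 2 + 2η(1 - η)(c - y)²`, and `2(1 - η) ≥ 1`.
  nlinarith [sq_nonneg (c' - c + 2 * η * (c - y)),
    mul_nonneg (mul_nonneg hη₀.le (sub_nonneg.2 hη₁.le)) (sq_nonneg (c - y))]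

/-- Telescoping of the one-step gains. Carrying the Hermitian exponent `H` through the induction
keeps the logarithm of the estimate available. -/
lemma exists_log_megEstimate [Nonempty n] {ρ : Matrix n n ℂ} (hρ : IsDensityMatrix ρ) {η : ℝ}
    (hη₀ : 0 < η) (hη₁ : η < 1 / 2) {X : ℕ → Matrix n n ℂ} (hX : ∀ t, (X t).IsHermitian)
    (hXu : ∀ t, X t ∈ Matrix.unitaryGroup n ℂ) (t : ℕ) :
    ∃ H : Matrix n n ℂ, H.IsHermitian ∧ (NormedSpace.exp H).trace = 1 ∧
      NormedSpace.exp H = megEstimate ρ η X (t + 1) ∧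
      η * ∑ k ∈ Finset.range t, ((megEstimate ρ η X (k + 1) - ρ) * X (k + 1)).trace.re ^ 2 ≤
        Real.log (Fintype.card n) + (ρ * H).trace.re := by
  induction t with
  | zero =>
    obtain ⟨H, hH, htr, he, hHd⟩ := exists_log_smul_one (n := n)
    refine ⟨H, hH, htr, by rw [he]; rfl, ?_⟩
    rw [hHd]
    simp [hρ.trace_eq_one, -Complex.natCast_log]
  | succ t ih =>
    obtain ⟨H, hH, htr, he, hsum⟩ := ih
    obtain ⟨H', hH', htr', he', hle⟩ := exists_log_megUpdate_progress hH htr (hX (t + 1))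
      (hXu (t + 1)) hρ.trace_eq_one hη₀ hη₁
    refine ⟨H', hH', htr', by rw [he', he]; rfl, ?_⟩
    rw [Finset.sum_range_succ, mul_add, ← he]
    linarith

lemma megEstimate_isHermitian_and_trace [Nonempty n] {ρ : Matrix n n ℂ} (hρ : IsDensityMatrix ρ) {η : ℝ}
    (hη₀ : 0 < η) (hη₁ : η < 1 / 2) {X : ℕ → Matrix n n ℂ} (hX : ∀ t, (X t).IsHermitian)
    (hXu : ∀ t, X t ∈ Matrix.unitaryGroup n ℂ) (t : ℕ) :
    (megEstimate ρ η X (t + 1)).IsHermitian ∧ (megEstimate ρ η X (t + 1)).trace = 1 := by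
  obtain ⟨H, hH, htr, he, -⟩ := exists_log_megEstimate hρ hη₀ hη₁ hX hXu t
  exact ⟨he ▸ hH.exp, he ▸ htr⟩

/-- The total squared prediction error is bounded independently of the number of rounds. -/
lemma sum_trace_re_sq_le [Nonempty n] {ρ : Matrix n n ℂ} (hρ : IsDensityMatrix ρ) {η : ℝ}
    (hη₀ : 0 < η) (hη₁ : η < 1 / 2) {X : ℕ → Matrix n n ℂ} (hX : ∀ t, (X t).IsHermitian)
    (hXu : ∀ t, X t ∈ Matrix.unitaryGroup n ℂ) (t : ℕ) :
    η * ∑ k ∈ Finset.range t, ((megEstimate ρ η X (k + 1) - ρ) * X (k + 1)).trace.re ^ 2 ≤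
      Real.log (Fintype.card n) := by
  obtain ⟨H, hH, htr, -, h⟩ := exists_log_megEstimate hρ hη₀ hη₁ hX hXu t
  linarith [trace_mul_re_nonpos hρ.posSemidef hH htr]

/-- Causality: this is what makes the estimate at time `t` independent of the measurement at time
`t`. -/
lemma megEstimate_congr (ρ : Matrix n n ℂ) (η : ℝ) {X Y : ℕ → Matrix n n ℂ} (t : ℕ)
    (h : ∀ k < t, X k = Y k) : megEstimate ρ η X t = megEstimate ρ η Y t := by
  induction t with
  | zero => rfl
  | succ t ih =>
    rcases t with _ | t
    · rfl
    · simp only [megEstimate]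
      rw [ih fun k hk => h k (by omega), h (t + 1) (by omega)]

end Update

/-! ### Averaging over measurements and over time. -/

section Probability

lemma integrable_comp_of_finite {Ω V : Type*} [MeasurableSpace Ω] [MeasurableSpace V] [Finite V]
    [MeasurableSingletonClass V] {P : Measure Ω} [IsFiniteMeasure P] {Y : Ω → V}
    (hY : Measurable Y) (g : V → ℝ) : Integrable (fun ω => g (Y ω)) P :=
  (Integrable.of_finite (μ := P.map Y) (f := g)).comp_measurable hY

lemma integral_uniformOn_univ {N : Type*} [MeasurableSpace N] [Fintype N]
    [MeasurableSingletonClass N] (f : N → ℝ) :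
    ∫ x, f x ∂(uniformOn (Set.univ : Set N)) = (Fintype.card N : ℝ)⁻¹ * ∑ x, f x := by
  rw [integral_fintype Integrable.of_finite, Finset.mul_sum]
  refine Finset.sum_congr rfl fun x _ => ?_
  rw [measureReal_def, uniformOn_univ]
  simp

lemma integral_indepFun_uniform {Ω V N : Type*} [MeasurableSpace Ω] [MeasurableSpace V] [Finite V]
    [MeasurableSingletonClass V] [MeasurableSpace N] [Fintype N] [MeasurableSingletonClass N]
    {P : Measure Ω} [IsProbabilityMeasure P] {Y : Ω → V} {Z : Ω → N} (hY : Measurable Y)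
    (hZ : Measurable Z) (hYZ : IndepFun Y Z P) (hunif : P.map Z = uniformOn Set.univ)
    (F : V → N → ℝ) :
    ∫ ω, F (Y ω) (Z ω) ∂P = (Fintype.card N : ℝ)⁻¹ * ∫ ω, ∑ x, F (Y ω) x ∂P := by
  have hmap := (indepFun_iff_map_prod_eq_prod_map_map hY.aemeasurable hZ.aemeasurable).1 hYZ
  have hPY : IsProbabilityMeasure (P.map Y) := Measure.isProbabilityMeasure_map hY.aemeasurable
  have hPZ : IsProbabilityMeasure (P.map Z) := Measure.isProbabilityMeasure_map hZ.aemeasurable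
  calc ∫ ω, F (Y ω) (Z ω) ∂P
      = ∫ p, F p.1 p.2 ∂(P.map fun ω => (Y ω, Z ω)) := by
        rw [integral_map (hY.prodMk hZ).aemeasurable
          (measurable_of_finite _).aestronglyMeasurable]
    _ = ∫ v, ∫ x, F v x ∂(P.map Z) ∂(P.map Y) := by
        rw [hmap, integral_prod _ Integrable.of_finite]
    _ = _ := by
        simp_rw [hunif, integral_uniformOn_univ]
        rw [integral_const_mul, integral_map hY.aemeasurable
          (measurable_of_finite _).aestronglyMeasurable]

lemma prod_uniformOn_Icc_real {Ω : Type*} [MeasurableSpace Ω] (P : Measure Ω)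
    [IsProbabilityMeasure P] (T : ℕ) {s : Set (Ω × ℕ)}
    (hs : ∀ t, MeasurableSet {ω | (ω, t) ∈ s}) :
    (P.prod (uniformOn (Set.Icc 1 T))).real s =
      (T : ℝ)⁻¹ * ∑ t ∈ Finset.Icc 1 T, P.real {ω | (ω, t) ∈ s} := by
  have hsm : MeasurableSet s := by
    have : s = ⋃ t, {ω | (ω, t) ∈ s} ×ˢ {t} := by
      ext ⟨ω, t⟩
      simp
    rw [this]
    exact MeasurableSet.iUnion fun t => (hs t).prod (measurableSet_singleton t)
  have hcount : Measure.count (Set.Icc 1 T) = (T : ENNReal) := by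
    rw [← Finset.coe_Icc, Measure.count_apply_finset]
    simp
  rw [measureReal_def, Measure.prod_apply_symm hsm, uniformOn, ProbabilityTheory.cond, hcount,
    lintegral_smul_measure, ← Finset.coe_Icc, lintegral_finset, smul_eq_mul, ENNReal.toReal_mul,
    ENNReal.toReal_inv, ENNReal.toReal_natCast, ENNReal.toReal_sum]
  · simp [measureReal_def, Set.preimage]
  · intro t _
    simp

variable {m : ℕ} {Ω : Type*} [MeasurableSpace Ω] {P : Measure Ω} [IsProbabilityMeasure P]
  {S : ℕ → Ω → NonIdentityPauli m} {ρ : Matrix (QubitBasis m) (QubitBasis m) ℂ} {η : ℝ}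

/-- The estimate at time `t` as a function of the measurement choices before time `t`. -/
noncomputable def estimateOfHistory (ρ : Matrix (QubitBasis m) (QubitBasis m) ℂ) (η : ℝ) (t : ℕ)
    (v : Finset.range t → NonIdentityPauli m) : Matrix (QubitBasis m) (QubitBasis m) ℂ :=
  -- The value `0` outside the history is never read.
  megEstimate ρ η (fun k => if h : k ∈ Finset.range t then pauliOperator (v ⟨k, h⟩).1 else 0) t

lemma megEstimate_eq_estimateOfHistory (s : ℕ → NonIdentityPauli m) (t : ℕ) :
    megEstimate ρ η (fun k => pauliOperator (s k).1) t =
      estimateOfHistory ρ η t fun i => s i :=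
  megEstimate_congr ρ η t fun k hk => by simp [hk]

lemma measurable_history (hS : ∀ t, Measurable (S t)) (t : ℕ) :
    Measurable fun ω (i : Finset.range t) => S i ω :=
  measurable_pi_lambda _ fun i => hS i

lemma integrable_frobeniusNorm_sq (hS : ∀ t, Measurable (S t)) (t : ℕ) :
    Integrable (fun ω => frobeniusNorm
      (megEstimate ρ η (fun k => pauliOperator (S k ω).1) t - ρ) ^ 2) P := by
  simp_rw [megEstimate_eq_estimateOfHistory]
  exact integrable_comp_of_finite (measurable_history hS t)
    fun v => frobeniusNorm (estimateOfHistory ρ η t v - ρ) ^ 2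

lemma integrable_trace_re_sq (hS : ∀ t, Measurable (S t)) (t : ℕ) :
    Integrable (fun ω => ((megEstimate ρ η (fun k => pauliOperator (S k ω).1) t - ρ) *
      pauliOperator (S t ω).1).trace.re ^ 2) P := by
  simp_rw [megEstimate_eq_estimateOfHistory]
  exact integrable_comp_of_finite ((measurable_history hS t).prodMk (hS t))
    fun v => ((estimateOfHistory ρ η t v.1 - ρ) * pauliOperator v.2.1).trace.re ^ 2

/-- Given the history the estimate is fixed and the next Pauli operator is still uniform, so
averaging over it gives the completeness sum divided by `4 ^ m - 1`. -/
lemma integral_trace_re_sq (hS_meas : ∀ t, Measurable (S t))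
    (hS_indep : iIndepFun S P) (hS_unif : ∀ t, P.map (S t) = uniformOn Set.univ)
    (hρ : IsDensityMatrix ρ) (hη₀ : 0 < η) (hη₁ : η < 1 / 2) (t : ℕ) :
    ∫ ω, ((megEstimate ρ η (fun k => pauliOperator (S k ω).1) (t + 1) - ρ) *
      pauliOperator (S (t + 1) ω).1).trace.re ^ 2 ∂P =
    (4 ^ m - 1 : ℝ)⁻¹ * (2 ^ m * ∫ ω, frobeniusNorm
      (megEstimate ρ η (fun k => pauliOperator (S k ω).1) (t + 1) - ρ) ^ 2 ∂P) := by
  have hind : IndepFun (fun ω (i : Finset.range (t + 1)) => S i ω) (S (t + 1)) P :=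
    (hS_indep.indepFun_finset (Finset.range (t + 1)) {t + 1} (by simp) hS_meas).comp
      (φ := id) (ψ := fun v : (({t + 1} : Finset ℕ) → NonIdentityPauli m) =>
        v ⟨t + 1, Finset.mem_singleton_self _⟩) measurable_id (measurable_pi_apply _)
  have h := integral_indepFun_uniform (measurable_history hS_meas (t + 1)) (hS_meas (t + 1)) hind
    (hS_unif (t + 1))
    fun v s => ((estimateOfHistory ρ η (t + 1) v - ρ) * pauliOperator s.1).trace.re ^ 2
  have hcard : (Fintype.card (NonIdentityPauli m) : ℝ) = 4 ^ m - 1 := by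
    rw [card_nonIdentityPauli, Nat.cast_sub (Nat.one_le_pow _ _ (by norm_num))]
    simp
  have hE : ∀ ω, estimateOfHistory ρ η (t + 1) (fun i => S i ω) =
      megEstimate ρ η (fun k => pauliOperator (S k ω).1) (t + 1) := fun ω =>
    (megEstimate_eq_estimateOfHistory (fun k => S k ω) (t + 1)).symm
  simp only [hE] at h
  rw [h, hcard, ← integral_const_mul (2 ^ m : ℝ)]
  refine congrArg _ (integral_congr_ae (ae_of_all _ fun ω => ?_))
  obtain ⟨hH, htr⟩ := megEstimate_isHermitian_and_trace hρ hη₀ hη₁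
    (fun k => pauliOperator_isHermitian (S k ω).1)
    (fun k => pauliOperator_mem_unitaryGroup (S k ω).1) t
  exact sum_nonIdentityPauli_trace_re_sq (hH.sub hρ.posSemidef.isHermitian)
    (by rw [Matrix.trace_sub, htr, hρ.trace_eq_one, sub_self])

lemma sum_integral_frobeniusNorm_sq_le (hm : 1 ≤ m) (hS_meas : ∀ t, Measurable (S t))
    (hS_indep : iIndepFun S P) (hS_unif : ∀ t, P.map (S t) = uniformOn Set.univ)
    (hρ : IsDensityMatrix ρ) (hη₀ : 0 < η) (hη₁ : η < 1 / 2) (T : ℕ) :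
    ∑ t ∈ Finset.Icc 1 T, ∫ ω, frobeniusNorm
      (megEstimate ρ η (fun k => pauliOperator (S k ω).1) t - ρ) ^ 2 ∂P ≤
      ((2 ^ m : ℝ) ^ 2 - 1) / (η * 2 ^ m) * Real.log (2 ^ m) := by
  have h1 : ∫ ω, η * ∑ k ∈ Finset.range T,
      ((megEstimate ρ η (fun k => pauliOperator (S k ω).1) (k + 1) - ρ) *
        pauliOperator (S (k + 1) ω).1).trace.re ^ 2 ∂P ≤ ∫ _, Real.log (2 ^ m) ∂P := by
    refine integral_mono (Integrable.const_mul (integrable_finsetSum _ fun k _ =>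
      integrable_trace_re_sq hS_meas (k + 1)) η) (integrable_const _) fun ω => ?_
    simpa using sum_trace_re_sq_le hρ hη₀ hη₁ (fun k => pauliOperator_isHermitian (S k ω).1)
      (fun k => pauliOperator_mem_unitaryGroup (S k ω).1) T
  rw [integral_const_mul, integral_finsetSum _ fun k _ => integrable_trace_re_sq hS_meas (k + 1)]
    at h1
  simp_rw [integral_trace_re_sq hS_meas hS_indep hS_unif hρ hη₀ hη₁, ← Finset.mul_sum] at h1
  have hlog : ∫ _, Real.log (2 ^ m) ∂P = Real.log (2 ^ m) := by simp
  have hIcc : Finset.Icc 1 T = (Finset.range T).map ⟨(· + 1), add_left_injective 1⟩ := by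
    ext k
    simp only [Finset.mem_Icc, Finset.mem_map, Finset.mem_range, Function.Embedding.coeFn_mk]
    exact ⟨fun h => ⟨k - 1, by omega, by omega⟩, fun ⟨j, h, e⟩ => by omega⟩
  have h4 : (4 : ℝ) ^ m = (2 ^ m) ^ 2 := by rw [← pow_mul, mul_comm, pow_mul]; norm_num
  have h2m : (1 : ℝ) < 2 ^ m := one_lt_pow₀ one_lt_two (by omega)
  have hN : (0 : ℝ) < (2 ^ m) ^ 2 - 1 := by nlinarith
  rw [hlog, h4] at h1
  rw [hIcc, Finset.sum_map, div_mul_eq_mul_div, le_div_iff₀ (by positivity)]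
  calc _ = ((2 ^ m : ℝ) ^ 2 - 1) * (η * (((2 ^ m : ℝ) ^ 2 - 1)⁻¹ * (2 ^ m * ∑ k ∈ Finset.range T,
        ∫ ω, frobeniusNorm
          (megEstimate ρ η (fun k => pauliOperator (S k ω).1) (k + 1) - ρ) ^ 2 ∂P))) := by
        simp only [Function.Embedding.coeFn_mk]
        field_simp
    _ ≤ _ := mul_le_mul_of_nonneg_left h1 hN.le

/-- Markov's inequality averaged over a uniform time. -/
lemma one_sub_le_successProb (hm : 1 ≤ m) (hS_meas : ∀ t, Measurable (S t))
    (hS_indep : iIndepFun S P) (hS_unif : ∀ t, P.map (S t) = uniformOn Set.univ)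
    (hρ : IsDensityMatrix ρ) (hη₀ : 0 < η) (hη₁ : η < 1 / 2) {α : ℝ} (hα₀ : 0 < α)
    {T : ℕ} (hT : 1 ≤ T) :
    1 - ((2 ^ m : ℝ) ^ 2 - 1) / (η * 2 ^ m) * Real.log (2 ^ m) * (T : ℝ) ^ (-(1 - α)) ≤
      successProb P S ρ η α T := by
  have hT0 : (0 : ℝ) < T := by exact_mod_cast hT
  set D : ℕ → Ω → ℝ := fun t ω => frobeniusNorm
      (megEstimate ρ η (fun k => pauliOperator (S k ω).1) t - ρ) ^ 2 with hD
  have hDm : ∀ t, Measurable (D t) := fun t => by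
    simp only [hD, megEstimate_eq_estimateOfHistory]
    exact (measurable_of_finite fun v => frobeniusNorm (estimateOfHistory ρ η t v - ρ) ^ 2).comp
      (measurable_history hS_meas t)
  have hsum := sum_integral_frobeniusNorm_sq_le hm hS_meas hS_indep hS_unif hρ hη₀ hη₁ T
  set C : ℝ := ((2 ^ m : ℝ) ^ 2 - 1) / (η * 2 ^ m) * Real.log (2 ^ m) with hC
  -- Markov at level `1 / t ^ α`; weakening `t ^ α` to `T ^ α` gives a factor common to all times.
  have hpt : ∀ t ∈ Finset.Icc 1 T, 1 - (T : ℝ) ^ α * ∫ ω, D t ω ∂P ≤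
      P.real {ω | D t ω < 1 / (t : ℝ) ^ α} := by
    intro t ht
    obtain ⟨ht1, htT⟩ := Finset.mem_Icc.1 ht
    have ht0 : (0 : ℝ) < t := by exact_mod_cast ht1
    have hpow : (0 : ℝ) < (t : ℝ) ^ α := Real.rpow_pos_of_pos ht0 α
    have hmk := mul_meas_ge_le_integral_of_nonneg (μ := P) (f := D t)
      (ae_of_all _ fun ω => sq_nonneg _) (integrable_frobeniusNorm_sq hS_meas t) (1 / (t : ℝ) ^ α)
    rw [div_mul_eq_mul_div, one_mul, div_le_iff₀ hpow] at hmk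
    have hc : P.real {ω | D t ω < 1 / (t : ℝ) ^ α} =
        1 - P.real {ω | 1 / (t : ℝ) ^ α ≤ D t ω} := by
      rw [← probReal_compl_eq_one_sub (measurableSet_le measurable_const (hDm t))]
      congr 1
      ext ω
      simp
    rw [hc]
    have hI : 0 ≤ ∫ ω, D t ω ∂P := integral_nonneg fun ω => sq_nonneg _
    have : (t : ℝ) ^ α ≤ (T : ℝ) ^ α :=
      Real.rpow_le_rpow ht0.le (by exact_mod_cast htT) hα₀.le
    nlinarith
  have hsucc : successProb P S ρ η α T =
      (T : ℝ)⁻¹ * ∑ t ∈ Finset.Icc 1 T, P.real {ω | D t ω < 1 / (t : ℝ) ^ α} :=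
    prod_uniformOn_Icc_real P T fun t => measurableSet_lt (hDm t) (g := fun _ => 1 / (t : ℝ) ^ α)
      measurable_const
  have h1 := Finset.sum_le_sum hpt
  rw [Finset.sum_sub_distrib, ← Finset.mul_sum] at h1
  have hTa : (T : ℝ) ^ (-(1 - α)) = (T : ℝ)⁻¹ * (T : ℝ) ^ α := by
    rw [neg_sub, sub_eq_add_neg, add_comm, Real.rpow_add hT0, Real.rpow_neg_one]
  have h2 : (T : ℝ) - (T : ℝ) ^ α * C ≤
      ∑ t ∈ Finset.Icc 1 T, P.real {ω | D t ω < 1 / (t : ℝ) ^ α} := by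
    refine le_trans ?_ h1
    simp only [Finset.sum_const, Nat.card_Icc, add_tsub_cancel_right, nsmul_eq_mul, mul_one]
    exact sub_le_sub_left (mul_le_mul_of_nonneg_left hsum (by positivity)) _
  have h3 := mul_le_mul_of_nonneg_left h2 (inv_nonneg.2 hT0.le)
  rw [mul_sub, inv_mul_cancel₀ hT0.ne'] at h3
  rw [hsucc, hTa]
  refine le_trans (le_of_eq ?_) h3
  ring

end Probability

end MEG

/-! ### The explicit threshold and the limit. -/

theorem mainTheorem1 (m d : ℕ) (hm : 1 ≤ m) (hd : d = 2 ^ m)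
    {Ω : Type*} [MeasurableSpace Ω] (P : Measure Ω) [IsProbabilityMeasure P]
    (S : ℕ → Ω → MEG.NonIdentityPauli m) (hS_meas : ∀ t, Measurable (S t))
    (hS_indep : iIndepFun S P) (hS_unif : ∀ t, P.map (S t) = uniformOn Set.univ)
    (ρ : Matrix (MEG.QubitBasis m) (MEG.QubitBasis m) ℂ) (hρ : MEG.IsDensityMatrix ρ)
    (η : ℝ) (hη₀ : 0 < η) (hη₁ : η < 1 / 2) (α : ℝ) (hα₀ : 0 < α) (hα₁ : α < 1) :
    (∀ δ : ℝ, 0 < δ → δ < 1 → ∀ T : ℕ,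
      (((((d : ℝ) ^ 2 - 1) / (η * d)) * Real.log d + 2) / δ) ^ (3 / (1 - α)) < (T : ℝ) →
        1 - δ ≤ MEG.successProb P S ρ η α T) ∧
    Tendsto (fun T : ℕ => MEG.successProb P S ρ η α T) atTop (𝓝 1) := by
  have key := fun {T : ℕ} (hT : 1 ≤ T) =>
    MEG.one_sub_le_successProb hm hS_meas hS_indep hS_unif hρ hη₀ hη₁ hα₀ hT
  have hd' : (d : ℝ) = 2 ^ m := by rw [hd]; push_cast; rfl
  rw [← hd'] at key
  have hd1 : (1 : ℝ) ≤ d := by rw [hd']; exact one_le_pow₀ one_le_two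
  have hC0 : 0 ≤ (((d : ℝ) ^ 2 - 1) / (η * d)) * Real.log d :=
    mul_nonneg (div_nonneg (by nlinarith) (by positivity)) (Real.log_nonneg hd1)
  set C : ℝ := (((d : ℝ) ^ 2 - 1) / (η * d)) * Real.log d
  have hα : 0 < 1 - α := sub_pos.2 hα₁
  refine ⟨fun δ hδ₀ hδ₁ T hT => ?_, ?_⟩
  · set B : ℝ := (C + 2) / δ with hB
    have hB1 : 1 ≤ B := by rw [hB, one_le_div hδ₀]; linarith
    have hT0 : (0 : ℝ) < T := (Real.rpow_pos_of_pos (by linarith) _).trans hT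
    refine le_trans ?_ (key (by exact_mod_cast hT0))
    have hBT : B ≤ (T : ℝ) ^ (1 - α) := by
      -- Since `B ≥ 1`, the exponent `1 / (1 - α)` would already suffice; the `3` is slack. The
      -- summand `2` in `B` serves to ensure `B ≥ 1`.
      calc B = B ^ (1 : ℝ) := (Real.rpow_one B).symm
        _ ≤ B ^ (3 / (1 - α) * (1 - α)) :=
            Real.rpow_le_rpow_of_exponent_le hB1 (by rw [div_mul_cancel₀ _ hα.ne']; norm_num)
        _ = (B ^ (3 / (1 - α))) ^ (1 - α) := Real.rpow_mul (by linarith) _ _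
        _ ≤ _ := Real.rpow_le_rpow (by positivity) hT.le hα.le
    have hTp : 0 < (T : ℝ) ^ (1 - α) := Real.rpow_pos_of_pos hT0 _
    rw [Real.rpow_neg hT0.le, ← div_eq_mul_inv]
    refine sub_le_sub_left ((div_le_iff₀ hTp).2 ?_) 1
    have : δ * B = C + 2 := by rw [hB]; field_simp
    nlinarith
  · have h0 : Tendsto (fun T : ℕ => 1 - C * (T : ℝ) ^ (-(1 - α))) atTop (𝓝 1) := by
      simpa using ((tendsto_rpow_neg_atTop hα).comp
        tendsto_natCast_atTop_atTop).const_mul C |>.const_sub 1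
    refine tendsto_of_tendsto_of_tendsto_of_le_of_le' h0 tendsto_const_nhds ?_ ?_
    · filter_upwards [eventually_ge_atTop 1] with T hT using key hT
    · filter_upwards [eventually_ge_atTop 1] with T hT
      have := isProbabilityMeasure_uniformOn (Set.finite_Icc 1 T) ⟨1, le_rfl, hT⟩
      exact measureReal_le_one
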